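/- Let $S(n,k)$ denote the Stirling numbers of the second kind. For $n=0,1,2,\dots$ and real $r>0$ put $$\omega_n(x)=\sum_{k=0}^{n}S(n,k)\,k!\,x^k,\qquad \omega_{n,r}(x)=\frac{1}{\Gamma(r)}\sum_{k=0}^{n}S(n,k)\,\Gamma(k+r)\,x^k .$$ For real $a$, $\int_{a-i\infty}^{a+i\infty}$ denotes integration along the vertical line $s=a+it$, $-\infty<t<\infty$. All the integrals below converge absolutely, and the following identities hold. 1. For every real $r\ge 0$, every $0<x<1$, every $n=0,1,2,\dots$ and every $0<a<1$, $$\frac{1}{(1+x)^{r+1}}\,\omega_{n,r+1}\!\left(\frac{-x}{1+x}\right)=\frac{(-1)^n}{2\pi i\,\Gamma(r+1)}\int_{a-i\infty}^{a+i\infty}x^{-s}s^n\,\Gamma(s)\,\Gamma(r+1-s)\,ds .$$ 2. For every $x>0$, every $n=0,1,2,\dots$ and every $a>n+1$, $$\frac{e^x}{e^x-1}\,\omega_n\!\left(\frac{1}{e^x-1}\right)=\delta_{n,0}+\frac{1}{2\pi i}\int_{a-i\infty}^{a+i\infty}x^{-s}\zeta(s-n)\,\Gamma(s)\,ds ,$$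 where $\zeta$ is the Riemann zeta function, $\delta_{0,0}=1$ and $\delta_{n,0}=0$ for $n\ge 1$. 3. For every $x>0$ and every $n=1,2,3,\dots$, $$\frac{e^x}{e^x+1}\,\omega_n\!\left(\frac{-1}{e^x+1}\right)=(-1)^n\int_0^\infty \sin\!\left(xt+\frac{\pi n}{2}\right)\frac{t^n}{\sinh(\pi t)}\,dt .$$ 4. For every $x>0$ and every $n=1,2,3,\dots$, $$\frac{e^x}{e^x-1}\,\omega_n\!\left(\frac{1}{e^x-1}\right)=\frac{n!}{x^{n+1}}+2(-1)^n\int_0^\infty \sin\!\left(xt+\frac{\pi n}{2}\right)\frac{t^n}{e^{2\pi t}-1}\,dt .$$ -/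

import Mathlib

open MeasureTheory Set

noncomputable section

/-- The geometric polynomial `ω_n(x) = ∑_{k=0}^n S(n,k) k! x^k`. -/
def geomPoly (n : ℕ) (x : ℝ) : ℝ :=
  ∑ k ∈ Finset.range (n + 1), (Nat.stirlingSecond n k : ℝ) * (Nat.factorial k : ℝ) * x ^ k

/-- The generalized geometric polynomial
`ω_{n,r}(x) = Γ(r)⁻¹ ∑_{k=0}^n S(n,k) Γ(k+r) x^k`, for real `r > 0`. -/
def genGeomPoly (n : ℕ) (r x : ℝ) : ℝ :=
  1 / Real.Gamma r *
    ∑ k ∈ Finset.range (n + 1), (Nat.stirlingSecond n k : ℝ) * Real.Gamma (k + r) * x ^ k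

/-- The contour integral `∫_{a-i∞}^{a+i∞} F(s) ds` along `s = a + it`, `ds = i dt`. -/
def vertLineIntegral (a : ℝ) (F : ℂ → ℂ) : ℂ :=
  Complex.I * ∫ t : ℝ, F ((a : ℂ) + (t : ℂ) * Complex.I)

end

/-! Everything rests on `x^n = ∑ S(n,k) (x)_k`, with `(x)_k` the falling factorial. For the
Gamma-product integral, the Beta integral says that `x^k (1+x)^(-(ρ+k))` has Mellin transform
`Γ(s+k) Γ(ρ-s) / Γ(ρ+k)`. Inverting it for each `k` and using `(-1)^k Γ(s+k) = (-s)_k Γ(s)`, the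
weights `S(n,k)` recombine the integrands into `(-s)^n Γ(s) Γ(ρ-s)`. For the other three, the
geometric polynomial sums `∑ m^n z^m` (`hasSum_pow_mul_geometric`), with `z = e^(-x)` or `z =
-e^(-x)`. Writing each `e^(-mx)`, `m ≥ 1`, as a Cahen–Mellin integral and summing inside gives
`ζ(s-n)`; the `m = 0` term is `δ_{n,0}`. For the sine integrals, the Lipschitz formula turns `∑ m^n
z^m` into `∑ n!/(x - 2πi(β+d))^(n+1)` over integers `d`, with `β = 0` for `z = e^(-x)` and `β = 1/2`
for `z = -e^(-x)`. Conjugate terms pair into real parts, each real part is a Laplace integral of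
`t^n`, and summing the exponentials as a geometric series produces the kernels `1/(e^(2πt) - 1)` and
`1/(2 sinh πt)`. -/

/-! ### Stirling numbers and power-weighted geometric series -/

/-- Powers expand in falling factorials with Stirling numbers of the second kind. -/
theorem pow_eq_sum_stirlingSecond_mul_descPochhammer {R : Type*} [CommRing R] (n : ℕ) (x : R) :
    x ^ n = ∑ k ∈ Finset.range (n + 1),
      (Nat.stirlingSecond n k : R) * (descPochhammer R k).eval x := by
  induction n with
  | zero => simp
  | succ n ih =>
    -- Index shift: the terms gained and lost vanish, at `0` by the factor `k` and at `n + 1` by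
    -- `S(n, n+1) = 0`.
    have h1 : ∑ k ∈ Finset.range (n + 1), ((k : R) + 1) * (Nat.stirlingSecond n (k + 1) : R) *
        (descPochhammer R (k + 1)).eval x =
        ∑ k ∈ Finset.range (n + 1), (k : R) * (Nat.stirlingSecond n k : R) *
        (descPochhammer R k).eval x := by
      have h2 := Finset.sum_range_succ' (fun k : ℕ => (k : R) * (Nat.stirlingSecond n k : R) *
        (descPochhammer R k).eval x) (n + 1)
      rw [Finset.sum_range_succ, Nat.stirlingSecond_eq_zero_of_lt (Nat.lt_succ_self n)] at h2
      simpa using h2.symm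
    rw [Finset.sum_range_succ', pow_succ, ih, Finset.sum_mul]
    simp only [Nat.stirlingSecond_succ_succ, Nat.stirlingSecond_succ_zero, Nat.cast_zero, zero_mul,
      add_zero, Nat.cast_add, Nat.cast_mul, add_mul, Finset.sum_add_distrib, Nat.cast_one] at h1 ⊢
    rw [h1, ← Finset.sum_add_distrib]
    refine Finset.sum_congr rfl fun k _ => ?_
    rw [descPochhammer_succ_eval]
    ring

theorem hasSum_descFactorial_mul_geometric (k : ℕ) {z : ℝ} (hz : |z| < 1) :
    HasSum (fun m : ℕ => (m.descFactorial k : ℝ) * z ^ m)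
      (k.factorial * z ^ k / (1 - z) ^ (k + 1)) := by
  have h := (hasSum_choose_mul_geometric_of_norm_lt_one k (r := z) (by simpa using hz)).mul_left
    (k.factorial * z ^ k)
  -- Terms with `m < k` vanish, so the sum is a shifted negative binomial series.
  rw [← (add_left_injective k).hasSum_iff]
  · convert! h using 1
    · ext m
      simp only [Function.comp, Nat.descFactorial_eq_factorial_mul_choose, pow_add]
      push_cast
      ring
    · ring
  · intro m hm
    have : m < k := by
      by_contra hk
      exact hm ⟨m - k, by simp; omega⟩
    simp [Nat.descFactorial_eq_zero_iff_lt.2 this]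

/-- The power-weighted geometric series, summed by a geometric polynomial. -/
theorem hasSum_pow_mul_geometric (n : ℕ) {z : ℝ} (hz : |z| < 1) :
    HasSum (fun m : ℕ => (m : ℝ) ^ n * z ^ m) (1 / (1 - z) * geomPoly n (z / (1 - z))) := by
  have h := hasSum_sum (s := Finset.range (n + 1)) fun k _ =>
    (hasSum_descFactorial_mul_geometric k hz).mul_left (Nat.stirlingSecond n k : ℝ)
  have hz1 : 1 - z ≠ 0 := by linarith [(abs_lt.1 hz).2]
  convert! h using 1
  · ext m
    rw [pow_eq_sum_stirlingSecond_mul_descPochhammer, Finset.sum_mul]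
    simp only [descPochhammer_eval_eq_descFactorial, mul_assoc]
  · rw [geomPoly, Finset.mul_sum]
    refine Finset.sum_congr rfl fun k _ => ?_
    rw [div_pow, pow_succ]
    field_simp

/-! ### Size and integrability of Gamma on vertical lines -/

namespace Complex

theorem norm_Gamma_le_Gamma_re {s : ℂ} (hs : 0 < s.re) : ‖Gamma s‖ ≤ Real.Gamma s.re := by
  rw [Gamma_eq_integral hs, Real.Gamma_eq_integral hs, GammaIntegral]
  refine (norm_integral_le_integral_norm _).trans_eq ?_
  refine setIntegral_congr_fun measurableSet_Ioi fun x hx => ?_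
  simp only [norm_mul, norm_cpow_eq_rpow_re_of_pos hx, Complex.norm_of_nonneg (Real.exp_pos _).le]
  simp

/-- Since `‖s‖ ≤ ‖s + m‖` for `Re s > 0`, each factor `s` is absorbed by one use of the functional
equation. This gives polynomial decay of every order without Stirling's formula. -/
theorem norm_pow_mul_Gamma_le {s : ℂ} (hs : 0 < s.re) (m : ℕ) :
    ‖s ^ m * Gamma s‖ ≤ Real.Gamma (s.re + m) := by
  have key : ‖s ^ m * Gamma s‖ ≤ ‖Gamma (s + m)‖ := by
    induction m with
    | zero => simp
    | succ m ih =>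
      have hne : s + m ≠ 0 := fun h => by
        have := congrArg re h
        simp at this
        have := Nat.cast_nonneg (α := ℝ) m
        linarith
      have hle : ‖s‖ ≤ ‖s + m‖ := by
        rw [Complex.norm_def, Complex.norm_def]
        refine Real.sqrt_le_sqrt ?_
        simp only [normSq_apply, add_re, add_im, natCast_re, natCast_im, add_zero]
        have := Nat.cast_nonneg (α := ℝ) m
        nlinarith
      rw [Nat.cast_succ, ← add_assoc, Gamma_add_one _ hne, pow_succ', mul_assoc, norm_mul,
        norm_mul (s + _)]
      gcongr
  refine key.trans ((norm_Gamma_le_Gamma_re ?_).trans_eq ?_)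
  · simp; positivity
  · simp

theorem continuous_Gamma_vertical {a : ℝ} (ha : 0 < a) :
    Continuous fun t : ℝ => Gamma ((a : ℂ) + t * I) := by
  refine continuous_iff_continuousAt.2 fun t => ?_
  refine ContinuousAt.comp (f := fun t : ℝ => (a : ℂ) + t * I) ?_ (by fun_prop)
  refine (differentiableAt_Gamma _ fun m h => ?_).continuousAt
  have := congrArg re h
  simp at this
  have := Nat.cast_nonneg (α := ℝ) m
  linarith

theorem verticalIntegrable_pow_mul_Gamma (n : ℕ) {a : ℝ} (ha : 0 < a) :
    VerticalIntegrable (fun s => s ^ n * Gamma s) a := by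
  refine (integrable_inv_one_add_sq.const_mul
    (Real.Gamma (a + n) + Real.Gamma (a + (n + 2 : ℕ)))).mono'
    (Continuous.aestronglyMeasurable (by
      have := continuous_Gamma_vertical ha
      fun_prop)) (Filter.Eventually.of_forall fun t => ?_)
  have hre : ((a : ℂ) + t * I).re = a := by simp
  have h1 := norm_pow_mul_Gamma_le (s := (a : ℂ) + t * I) (by rwa [hre]) n
  -- Two extra powers of `s` dominate `t^2`; together with `h1` this bounds the integrand by a
  -- constant over `1 + t^2`.
  have h2 := norm_pow_mul_Gamma_le (s := (a : ℂ) + t * I) (by rwa [hre]) (n + 2)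
  rw [hre] at h1 h2
  have h3 : t ^ 2 ≤ ‖(a : ℂ) + t * I‖ ^ 2 := by
    rw [← normSq_eq_norm_sq, normSq_add_mul_I]
    nlinarith
  rw [← div_eq_mul_inv, le_div_iff₀ (by positivity), mul_add, mul_one]
  refine add_le_add h1 (le_trans ?_ h2)
  rw [pow_add, mul_right_comm, norm_mul _ (_ ^ 2), norm_pow _ 2]
  gcongr

/-! ### Beta integral, Mellin inversion and the Gamma-product formula -/

theorem image_div_one_sub_Ioo : (fun u : ℝ => u / (1 - u)) '' Ioo 0 1 = Ioi 0 := by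
  ext x
  constructor
  · rintro ⟨u, ⟨h0, h1⟩, rfl⟩
    exact div_pos h0 (sub_pos.2 h1)
  · intro hx
    have hx : 0 < x := hx
    refine ⟨x / (1 + x), ⟨by positivity, (div_lt_one (by positivity)).2 (by linarith)⟩, ?_⟩
    field_simp
    ring

/-- The Beta integral in its half-line form, as a Mellin transform. -/
theorem hasMellin_one_add_rpow_neg {ρ : ℝ} {s : ℂ} (hs : 0 < s.re) (hρ : s.re < ρ) :
    HasMellin (fun x : ℝ => (((1 + x) ^ (-ρ) : ℝ) : ℂ)) s
      (Gamma s * Gamma (ρ - s) / Gamma ρ) := by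
  have hv : 0 < ((ρ : ℂ) - s).re := by simpa using hρ
  -- The substitution `x = u/(1-u)`, for which `1 + x = 1/(1-u)`, carries the half-line integral to
  -- the Beta integral on `(0,1)`.
  have hderiv : ∀ u ∈ Ioo (0 : ℝ) 1,
      HasDerivWithinAt (fun u : ℝ => u / (1 - u)) (1 / (1 - u) ^ 2) (Ioo 0 1) u := fun u hu => by
    have hu1 : 1 - u ≠ 0 := (sub_pos.2 hu.2).ne'
    have h := ((hasDerivAt_id u).div ((hasDerivAt_const u (1 : ℝ)).sub (hasDerivAt_id u)) hu1)
    refine (h.congr_deriv ?_).hasDerivWithinAt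
    simp
  have hinj : InjOn (fun u : ℝ => u / (1 - u)) (Ioo 0 1) := fun u hu v hv h => by
    have hu1 : 1 - u ≠ 0 := (sub_pos.2 hu.2).ne'
    have hv1 : 1 - v ≠ 0 := (sub_pos.2 hv.2).ne'
    simp only at h
    rw [div_eq_div_iff hu1 hv1] at h
    linarith
  have hcongr : ∀ u ∈ Ioo (0 : ℝ) 1, |1 / (1 - u) ^ 2| • (((u / (1 - u) : ℝ) : ℂ) ^ (s - 1) •
      (((1 + u / (1 - u)) ^ (-ρ) : ℝ) : ℂ)) =
      (u : ℂ) ^ (s - 1) * (1 - (u : ℂ)) ^ ((ρ : ℂ) - s - 1) := fun u hu => by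
    have hu1 : 0 < 1 - u := sub_pos.2 hu.2
    have hne : ((1 - u : ℝ) : ℂ) ≠ 0 := ofReal_ne_zero.2 hu1.ne'
    have e1 : 1 + u / (1 - u) = (1 - u)⁻¹ := by field_simp; ring
    have e2 : ((u / (1 - u) : ℝ) : ℂ) ^ (s - 1) =
        (u : ℂ) ^ (s - 1) / ((1 - u : ℝ) : ℂ) ^ (s - 1) := by
      rw [div_eq_mul_inv, ofReal_mul, mul_cpow_ofReal_nonneg hu.1.le (inv_pos.2 hu1).le, ofReal_inv,
        inv_cpow _ _ (by rw [arg_ofReal_of_nonneg hu1.le]; exact Real.pi_pos.ne), div_eq_mul_inv]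
    have e3 : (ρ : ℂ) - s - 1 = ρ - (s - 1) - (2 : ℕ) := by push_cast; ring
    rw [e1, Real.inv_rpow hu1.le, Real.rpow_neg hu1.le, inv_inv, e2, ofReal_cpow hu1.le,
      abs_of_nonneg (by positivity), e3,
      show (1 : ℂ) - u = ((1 - u : ℝ) : ℂ) by push_cast; rfl,
      cpow_sub ((ρ : ℂ) - (s - 1)) _ hne, cpow_sub (ρ : ℂ) _ hne, cpow_natCast]
    simp only [real_smul, smul_eq_mul, ofReal_div, ofReal_one, ofReal_pow]
    ring
  constructor
  · rw [MellinConvergent, ← image_div_one_sub_Ioo,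
      integrableOn_image_iff_integrableOn_abs_deriv_smul measurableSet_Ioo hderiv hinj,
      integrableOn_congr_fun hcongr measurableSet_Ioo, ← integrableOn_Ioc_iff_integrableOn_Ioo,
      ← intervalIntegrable_iff_integrableOn_Ioc_of_le zero_le_one]
    exact betaIntegral_convergent hs hv
  · have hB := betaIntegral_eq_Gamma_mul_div s (ρ - s) hs hv
    rw [add_sub_cancel] at hB
    rw [← hB, mellin, ← image_div_one_sub_Ioo,
      integral_image_eq_integral_abs_deriv_smul measurableSet_Ioo hderiv hinj,
      setIntegral_congr_fun measurableSet_Ioo hcongr, betaIntegral,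
      intervalIntegral.integral_of_le zero_le_one, integral_Ioc_eq_integral_Ioo]

theorem continuous_cpow_neg_vertical {x : ℝ} (hx : 0 < x) (a : ℝ) :
    Continuous fun t : ℝ => (x : ℂ) ^ (-((a : ℂ) + t * I)) := by
  refine Continuous.const_cpow (by fun_prop) (Or.inl (ofReal_ne_zero.2 hx.ne'))

theorem norm_cpow_neg_vertical {x : ℝ} (hx : 0 < x) (a t : ℝ) :
    ‖(x : ℂ) ^ (-((a : ℂ) + t * I))‖ = x ^ (-a) := by
  rw [norm_cpow_eq_rpow_re_of_pos hx]
  simp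

theorem VerticalIntegrable.cpow_neg_mul {f : ℂ → ℂ} {a x : ℝ} (hf : VerticalIntegrable f a)
    (hx : 0 < x) : VerticalIntegrable (fun s => (x : ℂ) ^ (-s) * f s) a :=
  Integrable.bdd_mul (c := x ^ (-a)) hf (continuous_cpow_neg_vertical hx a).aestronglyMeasurable
    (Filter.Eventually.of_forall fun t => (norm_cpow_neg_vertical hx a t).le)

theorem VerticalIntegrable.mul_Gamma_sub {f : ℂ → ℂ} {a ρ : ℝ} (hf : VerticalIntegrable f a)
    (ha : a < ρ) : VerticalIntegrable (fun s => f s * Gamma (ρ - s)) a := by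
  have e : ∀ t : ℝ, (ρ : ℂ) - (a + t * I) = ((ρ - a : ℝ) : ℂ) + ((-t : ℝ) : ℂ) * I := fun t => by
    push_cast; ring
  refine Integrable.mul_bdd (c := Real.Gamma (ρ - a)) hf ?_
    (Filter.Eventually.of_forall fun t => ?_)
  · simp only [e]
    exact ((continuous_Gamma_vertical (sub_pos.2 ha)).comp continuous_neg).aestronglyMeasurable
  · refine (norm_Gamma_le_Gamma_re ?_).trans_eq ?_ <;> simp [ha]

/-- This makes the `k`-dependence of the integrands a falling factorial at `-s`, ready for the
Stirling expansion. -/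
theorem Gamma_add_nat_mul_neg_one_pow {s : ℂ} (hs : 0 < s.re) (k : ℕ) :
    (-1) ^ k * Gamma (s + k) = (descPochhammer ℂ k).eval (-s) * Gamma s := by
  induction k with
  | zero => simp
  | succ k ih =>
    have hne : s + k ≠ 0 := fun h => by
      have := congrArg re h
      simp at this
      have := Nat.cast_nonneg (α := ℝ) k
      linarith
    rw [Nat.cast_succ, ← add_assoc, Gamma_add_one _ hne, descPochhammer_succ_eval, pow_succ]
    linear_combination (-(s + k)) * ih

theorem mellinInv_eq_vertLineIntegral (a x : ℝ) (f : ℂ → ℂ) :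
    mellinInv a f x =
      1 / (2 * (Real.pi : ℂ) * I) * vertLineIntegral a (fun s => (x : ℂ) ^ (-s) * f s) := by
  have : (Real.pi : ℂ) ≠ 0 := ofReal_ne_zero.2 Real.pi_ne_zero
  simp only [mellinInv, vertLineIntegral, smul_eq_mul, real_smul]
  rw [← mul_assoc]
  congr 1
  push_cast
  field_simp

/-- Mellin inversion for `x ^ k * (1 + x) ^ (-(ρ + k))`. -/
theorem pow_mul_one_add_rpow_eq_vertLineIntegral (k : ℕ) {ρ x a : ℝ} (hx : 0 < x) (ha : 0 < a)
    (haρ : a < ρ) :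
    VerticalIntegrable (fun s => (x : ℂ) ^ (-s) * (Gamma (s + k) * Gamma (ρ - s))) a ∧
    ((x ^ k * (1 + x) ^ (-(ρ + k)) * Real.Gamma (ρ + k) : ℝ) : ℂ) =
      1 / (2 * (Real.pi : ℂ) * I) *
        vertLineIntegral a (fun s => (x : ℂ) ^ (-s) * (Gamma (s + k) * Gamma (ρ - s))) := by
  have hk : (0 : ℝ) ≤ k := Nat.cast_nonneg k
  have hΓ : Gamma ((ρ + k : ℝ) : ℂ) ≠ 0 := by
    rw [Gamma_ofReal]
    exact ofReal_ne_zero.2 (Real.Gamma_pos_of_pos (by linarith)).ne'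
  have hM : ∀ s : ℂ, s.re = a →
      HasMellin (fun x : ℝ => (x : ℂ) ^ (k : ℂ) • (((1 + x) ^ (-(ρ + k)) : ℝ) : ℂ)) s
        (Gamma (s + k) * Gamma (ρ - s) / Gamma ((ρ + k : ℝ) : ℂ)) := fun s hs => by
    -- The factor `x^k` shifts `s` to `s + k`; the shift cancels in `(ρ + k) - (s + k)`.
    have h := hasMellin_one_add_rpow_neg (ρ := ρ + k) (s := s + k)
      (by simp [hs]; linarith) (by simp [hs]; linarith)
    refine ⟨MellinConvergent.cpow_smul.2 h.1, ?_⟩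
    rw [mellin_cpow_smul, h.2]
    congr 3
    push_cast
    ring
  have hint : VerticalIntegrable (fun s => Gamma (s + k) * Gamma (ρ - s)) a := by
    refine VerticalIntegrable.mul_Gamma_sub (f := fun s => Gamma (s + k)) ?_ haρ
    have h := verticalIntegrable_pow_mul_Gamma 0 (a := a + k) (by linarith)
    refine h.congr (Filter.Eventually.of_forall fun t => ?_)
    simp only [pow_zero, one_mul]
    congr 1
    push_cast
    ring
  refine ⟨hint.cpow_neg_mul hx, ?_⟩
  have hline : ∀ t : ℝ, ((a : ℂ) + t * I).re = a := fun t => by simp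
  have hinv := mellinInv_mellin_eq a
    (fun x : ℝ => (x : ℂ) ^ (k : ℂ) • (((1 + x) ^ (-(ρ + k)) : ℝ) : ℂ)) hx
    (hM a (by simp)).1
    ((hint.div_const (Gamma ((ρ + k : ℝ) : ℂ))).congr (Filter.Eventually.of_forall fun t =>
      (hM _ (hline t)).2.symm))
    (by
      simp only [cpow_natCast]
      have h1 : ContinuousAt (fun x : ℝ => (1 + x) ^ (-(ρ + k))) x :=
        ContinuousAt.rpow_const (by fun_prop) (Or.inl (by positivity))
      have h2 : ContinuousAt (fun x : ℝ => (((1 + x) ^ (-(ρ + k)) : ℝ) : ℂ)) x :=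
        continuous_ofReal.continuousAt.comp h1
      have h3 : ContinuousAt (fun x : ℝ => (x : ℂ) ^ k) x := by fun_prop
      exact h3.smul h2)
  rw [mellinInv_eq_vertLineIntegral] at hinv
  have hv : vertLineIntegral a (fun s => (x : ℂ) ^ (-s) *
      mellin (fun x : ℝ => (x : ℂ) ^ (k : ℂ) • (((1 + x) ^ (-(ρ + k)) : ℝ) : ℂ)) s) =
      vertLineIntegral a (fun s => (x : ℂ) ^ (-s) * (Gamma (s + k) * Gamma (ρ - s))) /
        Gamma ((ρ + k : ℝ) : ℂ) := by
    rw [vertLineIntegral, vertLineIntegral, mul_div_assoc, ← integral_div]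
    congr 2
    ext t
    rw [(hM _ (hline t)).2]
    ring
  rw [hv, ← mul_div_assoc, div_eq_iff hΓ] at hinv
  rw [hinv, cpow_natCast, Gamma_ofReal]
  push_cast
  rw [smul_eq_mul]

theorem verticalIntegrable_cpow_mul_pow_mul_Gamma_mul_Gamma_sub (n : ℕ) {ρ x a : ℝ} (hx : 0 < x)
    (ha : 0 < a) (haρ : a < ρ) :
    VerticalIntegrable (fun s => (x : ℂ) ^ (-s) * s ^ n * Gamma s * Gamma (ρ - s)) a := by
  have h := ((verticalIntegrable_pow_mul_Gamma n ha).cpow_neg_mul hx).mul_Gamma_sub haρ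
  simpa only [mul_assoc] using h

theorem genGeomPoly_eq_vertLineIntegral (n : ℕ) {ρ x a : ℝ} (hx : 0 < x) (ha : 0 < a)
    (haρ : a < ρ) :
    ((1 / (1 + x) ^ ρ * genGeomPoly n ρ (-x / (1 + x)) : ℝ) : ℂ) =
      (-1) ^ n / (2 * (Real.pi : ℂ) * I * Gamma ρ) *
        vertLineIntegral a (fun s => (x : ℂ) ^ (-s) * s ^ n * Gamma s * Gamma (ρ - s)) := by
  have hx1 : 0 < 1 + x := by linarith
  have hL : 1 / (1 + x) ^ ρ * genGeomPoly n ρ (-x / (1 + x)) =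
      1 / Real.Gamma ρ * ∑ k ∈ Finset.range (n + 1), (Nat.stirlingSecond n k : ℝ) * (-1) ^ k *
        (x ^ k * (1 + x) ^ (-(ρ + k)) * Real.Gamma (ρ + k)) := by
    rw [genGeomPoly, mul_left_comm, Finset.mul_sum]
    congr 1
    refine Finset.sum_congr rfl fun k _ => ?_
    rw [Real.rpow_neg hx1.le, Real.rpow_add_natCast hx1.ne', div_pow, neg_pow x, add_comm (k : ℝ)]
    field_simp
  have hsum : vertLineIntegral a (fun s => (x : ℂ) ^ (-s) * s ^ n * Gamma s * Gamma (ρ - s)) =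
      (-1) ^ n * ∑ k ∈ Finset.range (n + 1), (Nat.stirlingSecond n k : ℂ) * (-1) ^ k *
        vertLineIntegral a (fun s => (x : ℂ) ^ (-s) * (Gamma (s + k) * Gamma (ρ - s))) := by
    have hswap := integral_finsetSum (Finset.range (n + 1)) fun k _ =>
      (pow_mul_one_add_rpow_eq_vertLineIntegral k hx ha haρ).1.const_mul
        ((Nat.stirlingSecond n k : ℂ) * (-1) ^ k)
    simp only [integral_const_mul] at hswap
    simp only [vertLineIntegral, mul_left_comm _ I, ← Finset.mul_sum]
    rw [← hswap, ← integral_const_mul ((-1 : ℂ) ^ n)]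
    congr 1
    refine integral_congr_ae (Filter.Eventually.of_forall fun t => ?_)
    dsimp only
    have hs : 0 < ((a : ℂ) + t * I).re := by simpa using ha
    generalize (a : ℂ) + t * I = s at hs
    -- The falling factorials are taken at `-s`, which is the source of the sign `(-1)^n`.
    have e : s ^ n = (-1) ^ n * (-s) ^ n := by rw [← mul_pow]; simp
    rw [e, pow_eq_sum_stirlingSecond_mul_descPochhammer n (-s)]
    simp only [Finset.mul_sum, Finset.sum_mul]
    refine Finset.sum_congr rfl fun k _ => ?_
    linear_combination (-(-1) ^ n * x ^ (-s) * (Nat.stirlingSecond n k : ℂ) * Gamma (ρ - s)) *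
      Gamma_add_nat_mul_neg_one_pow hs k
  have hΓ : ((1 / Real.Gamma ρ : ℝ) : ℂ) = 1 / Gamma ρ := by rw [Gamma_ofReal]; push_cast; rfl
  rw [hL, hsum, ofReal_mul, hΓ, ofReal_sum, Finset.mul_sum, Finset.mul_sum, Finset.mul_sum]
  refine Finset.sum_congr rfl fun k _ => ?_
  rw [ofReal_mul, (pow_mul_one_add_rpow_eq_vertLineIntegral k hx ha haρ).2]
  have hsq : ((-1 : ℂ) ^ n) * (-1) ^ n = 1 := by rw [← mul_pow]; simp
  push_cast
  rw [div_eq_mul_inv ((-1 : ℂ) ^ n), mul_inv]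
  linear_combination (-(1 : ℂ) / Gamma ρ * ((Nat.stirlingSecond n k : ℂ) * (-1) ^ k *
    (1 / (2 * (Real.pi : ℂ) * I) * vertLineIntegral a
      (fun s => (x : ℂ) ^ (-s) * (Gamma (s + k) * Gamma (ρ - s)))))) * hsq

/-! ### The zeta integral -/

/-- The Cahen–Mellin integral. -/
theorem exp_neg_eq_vertLineIntegral {y a : ℝ} (hy : 0 < y) (ha : 0 < a) :
    ((Real.exp (-y) : ℝ) : ℂ) =
      1 / (2 * (Real.pi : ℂ) * I) * vertLineIntegral a (fun s => (y : ℂ) ^ (-s) * Gamma s) := by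
  have hline : ∀ t : ℝ, 0 < ((a : ℂ) + t * I).re := fun t => by simpa using ha
  have hM : ∀ s : ℂ, 0 < s.re → mellin (fun t : ℝ => ((Real.exp (-t) : ℝ) : ℂ)) s = Gamma s :=
    fun s hs => by rw [Gamma_eq_integral hs, GammaIntegral_eq_mellin]
  have hinv := mellinInv_mellin_eq a (fun t : ℝ => ((Real.exp (-t) : ℝ) : ℂ)) hy
    (by
      refine (GammaIntegral_convergent (s := a) (by simpa using ha)).congr_fun
        (fun t _ => ?_) measurableSet_Ioi
      simp only [smul_eq_mul, mul_comm])
    ((verticalIntegrable_pow_mul_Gamma 0 ha).congr (Filter.Eventually.of_forall fun t => by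
      simp only [pow_zero, one_mul, hM _ (hline t)]))
    (by fun_prop)
  rw [← hinv, mellinInv_eq_vertLineIntegral]
  simp only [vertLineIntegral, hM _ (hline _)]

theorem norm_one_div_natCast_add_one_cpow (m : ℕ) (s : ℂ) :
    ‖1 / ((m : ℂ) + 1) ^ s‖ = 1 / ((m : ℝ) + 1) ^ s.re := by
  rw [norm_div, norm_one]
  congr 1
  exact_mod_cast norm_cpow_eq_rpow_re_of_pos (x := (m : ℝ) + 1) (by positivity) s

theorem summable_one_div_natCast_add_one_rpow {σ : ℝ} (hσ : 1 < σ) :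
    Summable fun m : ℕ => 1 / ((m : ℝ) + 1) ^ σ := by
  have h := (summable_nat_add_iff 1).2 (Real.summable_one_div_nat_rpow.2 hσ)
  exact_mod_cast h

/-- Bounds zeta uniformly on a vertical line to the right of `1`, so that Gamma alone supplies
integrability. -/
theorem norm_riemannZeta_le {s : ℂ} (hs : 1 < s.re) :
    ‖riemannZeta s‖ ≤ ∑' m : ℕ, 1 / ((m : ℝ) + 1) ^ s.re := by
  rw [zeta_eq_tsum_one_div_nat_add_one_cpow hs]
  refine tsum_of_norm_bounded (summable_one_div_natCast_add_one_rpow hs).hasSum fun m => ?_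
  exact (norm_one_div_natCast_add_one_cpow m s).le

theorem hasSum_one_div_natCast_add_one_cpow {s : ℂ} (hs : 1 < s.re) :
    HasSum (fun m : ℕ => 1 / ((m : ℂ) + 1) ^ s) (riemannZeta s) := by
  rw [zeta_eq_tsum_one_div_nat_add_one_cpow hs]
  refine Summable.hasSum (Summable.of_norm ?_)
  simpa only [norm_one_div_natCast_add_one_cpow] using summable_one_div_natCast_add_one_rpow hs

theorem verticalIntegrable_cpow_mul_riemannZeta_mul_Gamma (n : ℕ) {x a : ℝ} (hx : 0 < x)
    (ha : (n : ℝ) + 1 < a) :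
    VerticalIntegrable (fun s => (x : ℂ) ^ (-s) * riemannZeta (s - n) * Gamma s) a := by
  have ha0 : 0 < a := by have := Nat.cast_nonneg (α := ℝ) n; linarith
  have hre : ∀ t : ℝ, ((a : ℂ) + t * I - n).re = a - n := fun t => by simp
  have hΓ : VerticalIntegrable (fun s => Gamma s) a := by
    simpa using verticalIntegrable_pow_mul_Gamma 0 ha0
  have h : VerticalIntegrable (fun s => riemannZeta (s - n) * Gamma s) a := by
    refine Integrable.bdd_mul (c := ∑' m : ℕ, 1 / ((m : ℝ) + 1) ^ (a - n)) hΓ ?_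
      (Filter.Eventually.of_forall fun t => ?_)
    · refine Continuous.aestronglyMeasurable (continuous_iff_continuousAt.2 fun t => ?_)
      refine ContinuousAt.comp (g := riemannZeta) (f := fun t : ℝ => (a : ℂ) + t * I - n)
        (differentiableAt_riemannZeta fun h => ?_).continuousAt (by fun_prop)
      have := hre t
      rw [h, one_re] at this
      linarith
    · have := norm_riemannZeta_le (s := (a : ℂ) + t * I - n) (by rw [hre]; linarith)
      rwa [hre] at this
  simpa only [mul_assoc] using h.cpow_neg_mul hx

theorem hasSum_pow_mul_exp_vertLineIntegral (n : ℕ) {x a : ℝ} (hx : 0 < x)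
    (ha : (n : ℝ) + 1 < a) :
    HasSum (fun m : ℕ => (((m + 1 : ℕ) ^ n * Real.exp (-x) ^ (m + 1) : ℝ) : ℂ))
      (1 / (2 * (Real.pi : ℂ) * I) *
        vertLineIntegral a (fun s => (x : ℂ) ^ (-s) * riemannZeta (s - n) * Gamma s)) := by
  have ha0 : 0 < a := by have := Nat.cast_nonneg (α := ℝ) n; linarith
  have hre : ∀ t : ℝ, ((a : ℂ) + t * I - n).re = a - n := fun t => by simp
  have hΓ : VerticalIntegrable (fun s => Gamma s) a := by
    simpa using verticalIntegrable_pow_mul_Gamma 0 ha0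
  set F : ℕ → ℝ → ℂ := fun m t => 1 / ((m : ℂ) + 1) ^ ((a : ℂ) + t * I - n) *
    ((x : ℂ) ^ (-((a : ℂ) + t * I)) * Gamma ((a : ℂ) + t * I)) with hF
  have hFint : ∀ m, Integrable (F m) := fun m => by
    refine Integrable.bdd_mul (c := 1 / ((m : ℝ) + 1) ^ (a - n)) (hΓ.cpow_neg_mul hx) ?_
      (Filter.Eventually.of_forall fun t => ?_)
    · have hne : (m : ℂ) + 1 ≠ 0 := Nat.cast_add_one_ne_zero m
      refine Continuous.aestronglyMeasurable (continuous_const.div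
        (Continuous.const_cpow (by fun_prop) (Or.inl hne)) fun t => ?_)
      simp [cpow_eq_zero_iff, hne]
    · rw [norm_one_div_natCast_add_one_cpow, hre]
  -- On the line the norm of the Dirichlet term does not depend on `t`, so these integrals are a
  -- constant times `(m+1)^(-(a-n))`. This is where `a > n + 1` enters the interchange.
  have hFsum : Summable fun m => ∫ t, ‖F m t‖ := by
    simp only [hF, norm_mul, norm_one_div_natCast_add_one_cpow, hre, integral_const_mul]
    exact (summable_one_div_natCast_add_one_rpow (by linarith)).mul_right _
  have h := (hasSum_integral_of_summable_integral_norm hFint hFsum).mul_left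
    (1 / (2 * (Real.pi : ℂ) * I) * I)
  have hvert : ∀ G : ℂ → ℂ, 1 / (2 * (Real.pi : ℂ) * I) * vertLineIntegral a G =
      1 / (2 * (Real.pi : ℂ) * I) * I * ∫ t : ℝ, G ((a : ℂ) + t * I) := fun G => by
    rw [vertLineIntegral]
    ring
  convert! h using 1
  · ext m
    have hm : (0 : ℝ) < (m + 1 : ℕ) := by positivity
    have hmne : ((m : ℂ) + 1) ≠ 0 := Nat.cast_add_one_ne_zero m
    rw [← Real.exp_nat_mul, mul_neg, ofReal_mul,
      exp_neg_eq_vertLineIntegral (mul_pos hm hx) ha0, hvert, mul_left_comm,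
      ← integral_const_mul ((((m + 1 : ℕ) : ℝ) ^ n : ℝ) : ℂ)]
    congr 1
    refine integral_congr_ae (Filter.Eventually.of_forall fun t => ?_)
    simp only [hF]
    generalize (a : ℂ) + t * I = s
    rw [ofReal_mul, mul_cpow_ofReal_nonneg hm.le hx.le]
    push_cast
    rw [cpow_sub _ _ hmne, cpow_neg (_ + _), cpow_natCast]
    field_simp
  · rw [hvert]
    congr 1
    refine integral_congr_ae (Filter.Eventually.of_forall fun t => ?_)
    have hz := (hasSum_one_div_natCast_add_one_cpow (s := (a : ℂ) + t * I - n)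
      (by rw [hre]; linarith)).tsum_eq
    simp only [hF]
    rw [tsum_mul_right, hz]
    ring

end Complex

theorem one_div_one_sub_exp_neg {x : ℝ} (hx : 0 < x) :
    1 / (1 - Real.exp (-x)) = Real.exp x / (Real.exp x - 1) ∧
    Real.exp (-x) / (1 - Real.exp (-x)) = 1 / (Real.exp x - 1) := by
  have h1 : Real.exp x - 1 ≠ 0 := by linarith [Real.add_one_lt_exp hx.ne']
  have h0 := Real.exp_pos x
  have h2 : (1 : ℝ) - (Real.exp x)⁻¹ = (Real.exp x - 1) / Real.exp x := by field_simp
  rw [Real.exp_neg, h2]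
  constructor <;> field_simp

theorem hasSum_pow_mul_exp_neg (n : ℕ) {x : ℝ} (hx : 0 < x) :
    HasSum (fun m : ℕ => (m : ℝ) ^ n * Real.exp (-x) ^ m)
      (Real.exp x / (Real.exp x - 1) * geomPoly n (1 / (Real.exp x - 1))) := by
  rw [← (one_div_one_sub_exp_neg hx).1, ← (one_div_one_sub_exp_neg hx).2]
  refine hasSum_pow_mul_geometric n ?_
  rw [abs_of_pos (Real.exp_pos _)]
  exact Real.exp_lt_one_iff.2 (by linarith)

theorem geomPoly_eq_vertLineIntegral_riemannZeta (n : ℕ) {x a : ℝ} (hx : 0 < x)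
    (ha : (n : ℝ) + 1 < a) :
    ((Real.exp x / (Real.exp x - 1) * geomPoly n (1 / (Real.exp x - 1)) : ℝ) : ℂ) =
      (if n = 0 then 1 else 0) + 1 / (2 * (Real.pi : ℂ) * Complex.I) *
        vertLineIntegral a
          (fun s : ℂ => (x : ℂ) ^ (-s) * riemannZeta (s - (n : ℂ)) * Complex.Gamma s) := by
  -- The removed `m = 0` term is `0^n`, which is `1` for `n = 0`: it is the Kronecker delta.
  have h1 := Complex.hasSum_ofReal.2 ((hasSum_nat_add_iff' 1).2 (hasSum_pow_mul_exp_neg n hx))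
  have h2 := h1.unique (Complex.hasSum_pow_mul_exp_vertLineIntegral n hx ha)
  rw [← h2]
  simp only [Finset.sum_range_one, Nat.cast_zero, pow_zero, mul_one, zero_pow_eq]
  push_cast
  split_ifs <;> push_cast <;> ring

/-! ### Laplace integrals summed over an arithmetic progression -/

namespace Complex

theorem integrableOn_pow_mul_exp_neg_mul_Ioi (n : ℕ) {w : ℂ} (hw : 0 < w.re) :
    IntegrableOn (fun t : ℝ => (t : ℂ) ^ n * exp (-w * t)) (Ioi 0) := by
  have h := integrableOn_rpow_mul_exp_neg_mul_rpow (p := 1) (s := n) (b := w.re)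
    (by have := Nat.cast_nonneg (α := ℝ) n; linarith) one_pos hw
  refine Integrable.mono' h (Continuous.aestronglyMeasurable (by fun_prop)) ?_
  refine (ae_restrict_iff' measurableSet_Ioi).2 (Filter.Eventually.of_forall fun t ht => ?_)
  rw [norm_mul, norm_pow, norm_real, Real.norm_of_nonneg (le_of_lt ht), norm_exp, Real.rpow_one,
    Real.rpow_natCast]
  simp

theorem integral_pow_mul_exp_neg_mul_Ioi (n : ℕ) {w : ℂ} (hw : 0 < w.re) :
    ∫ t in Ioi (0 : ℝ), (t : ℂ) ^ n * exp (-w * t) = n.factorial / w ^ (n + 1) := by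
  have hw0 : w ≠ 0 := fun h => by simp [h] at hw
  induction n with
  | zero =>
    have h := integral_exp_mul_complex_Ioi (a := -w) (by simpa using hw) 0
    simpa [neg_div_neg_eq] using h
  | succ n ih =>
    -- Integration by parts: the boundary terms of `t^(n+1) e^(-wt)` vanish, giving the recursion in
    -- `n`.
    have hd : ∀ t : ℝ, HasDerivAt (fun t : ℝ => (t : ℂ) ^ (n + 1) * exp (-w * t))
        ((n + 1) * ((t : ℂ) ^ n * exp (-w * t)) - w * ((t : ℂ) ^ (n + 1) * exp (-w * t))) t :=
      fun t => by
        have h1 : HasDerivAt (fun z : ℂ => z ^ (n + 1) * exp (-w * z))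
            (((n + 1 : ℕ) : ℂ) * (t : ℂ) ^ n * exp (-w * t) +
              (t : ℂ) ^ (n + 1) * (exp (-w * t) * -w)) t := by
          refine (hasDerivAt_pow (n + 1) (t : ℂ)).mul ?_
          simpa using ((hasDerivAt_id (t : ℂ)).const_mul (-w)).cexp
        refine h1.comp_ofReal.congr_deriv ?_
        push_cast
        ring
    have hlim : Filter.Tendsto (fun t : ℝ => (t : ℂ) ^ (n + 1) * exp (-w * t)) Filter.atTop
        (nhds 0) := by
      rw [tendsto_zero_iff_norm_tendsto_zero]
      have h := tendsto_rpow_mul_exp_neg_mul_atTop_nhds_zero ((n + 1 : ℕ) : ℝ) w.re hw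
      refine h.congr' ?_
      filter_upwards [Filter.eventually_ge_atTop 0] with t ht
      rw [norm_mul, norm_pow, norm_real, Real.norm_of_nonneg ht, norm_exp, Real.rpow_natCast]
      simp
    have i1 := (integrableOn_pow_mul_exp_neg_mul_Ioi n hw).const_mul ((n : ℂ) + 1)
    have i2 := (integrableOn_pow_mul_exp_neg_mul_Ioi (n + 1) hw).const_mul w
    have h := integral_Ioi_of_hasDerivAt_of_tendsto' (a := 0) (fun t _ => hd t) (i1.sub i2) hlim
    rw [integral_sub i1 i2, integral_const_mul, integral_const_mul, ih] at h
    simp only [ofReal_zero, ne_eq, Nat.add_eq_zero_iff, one_ne_zero, and_false, not_false_eq_true,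
      zero_pow, zero_mul, sub_zero] at h
    rw [eq_div_iff (pow_ne_zero _ hw0), pow_succ, Nat.factorial_succ]
    have h' := sub_eq_zero.1 h
    push_cast
    rw [mul_div_assoc', div_eq_iff (pow_ne_zero _ hw0)] at h'
    linear_combination -h'

theorem integral_norm_pow_mul_exp_neg_mul_Ioi (n : ℕ) {w : ℂ} (hw : 0 < w.re) :
    ∫ t in Ioi (0 : ℝ), ‖(t : ℂ) ^ n * exp (-w * t)‖ = n.factorial / w.re ^ (n + 1) := by
  have h := integral_pow_mul_exp_neg_mul_Ioi n (w := (w.re : ℂ)) (by simpa using hw)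
  apply ofReal_injective
  push_cast
  rw [← h, ← integral_complex_ofReal]
  refine setIntegral_congr_fun measurableSet_Ioi fun t ht => ?_
  simp only [norm_mul, norm_pow, norm_real, Real.norm_of_nonneg (le_of_lt ht), norm_exp]
  push_cast
  simp

/-- `∑ₖ e^{-(b + 2πk)t}` in closed form. -/
theorem hasSum_exp_neg_arithmetic (b : ℝ) {t : ℝ} (ht : 0 < t) :
    HasSum (fun k : ℕ => Real.exp (-(b + 2 * Real.pi * k) * t))
      (Real.exp (-b * t) / (1 - Real.exp (-(2 * Real.pi * t)))) := by
  have h := (hasSum_geometric_of_lt_one (Real.exp_pos (-(2 * Real.pi * t))).le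
    (Real.exp_lt_one_iff.2 (by have := Real.pi_pos; simp; positivity))).mul_left (Real.exp (-b * t))
  convert! h using 1
  ext k
  rw [← Real.exp_nat_mul, ← Real.exp_add]
  congr 1
  ring

/-- The denominator vanishes to first order at `0`, and one factor `t` of `t^n` compensates; hence
`n ≥ 1`. The bound `1/(1 - e^(-u)) ≤ 1 + 1/u` treats both ends at once. -/
theorem integrableOn_pow_mul_exp_div (n : ℕ) (hn : 1 ≤ n) (x : ℝ) {b : ℝ} (hb : 0 < b) :
    IntegrableOn (fun t : ℝ => (t : ℂ) ^ n * exp (x * t * I) *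
      ((Real.exp (-b * t) / (1 - Real.exp (-(2 * Real.pi * t))) : ℝ) : ℂ)) (Ioi 0) := by
  obtain ⟨n, rfl⟩ := Nat.exists_eq_add_of_le' hn
  have hbre : 0 < (b : ℂ).re := by simpa using hb
  have hpi := Real.pi_pos
  have hlt : ∀ t : ℝ, 0 < t → 0 < 1 - Real.exp (-(2 * Real.pi * t)) := fun t ht =>
    sub_pos.2 (Real.exp_lt_one_iff.2 (by simp; positivity))
  refine Integrable.mono' (((integrableOn_pow_mul_exp_neg_mul_Ioi (n + 1) hbre).norm).add
    ((integrableOn_pow_mul_exp_neg_mul_Ioi n hbre).norm.div_const (2 * Real.pi))) ?_ ?_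
  · refine ContinuousOn.aestronglyMeasurable ?_ measurableSet_Ioi
    refine ContinuousOn.mul (by fun_prop) (continuous_ofReal.comp_continuousOn ?_)
    exact ContinuousOn.div (by fun_prop) (by fun_prop) fun t ht => (hlt t ht).ne'
  · refine (ae_restrict_iff' measurableSet_Ioi).2 (Filter.Eventually.of_forall fun t ht => ?_)
    have ht : 0 < t := ht
    have hq := hlt t ht
    have h1 : 1 / (1 - Real.exp (-(2 * Real.pi * t))) ≤ 1 + 1 / (2 * Real.pi * t) := by
      have hu : 0 < 2 * Real.pi * t := by positivity
      generalize 2 * Real.pi * t = u at hq hu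
      have := Real.add_one_le_exp u
      rw [Real.exp_neg] at hq ⊢
      have h2 : (Real.exp u)⁻¹ ≤ (u + 1)⁻¹ := inv_anti₀ (by linarith) this
      rw [div_le_iff₀ hq]
      have h3 : (1 + 1 / u) * (1 - (u + 1)⁻¹) = 1 := by field_simp; ring
      calc (1 : ℝ) = (1 + 1 / u) * (1 - (u + 1)⁻¹) := h3.symm
        _ ≤ (1 + 1 / u) * (1 - (Real.exp u)⁻¹) := by gcongr
    simp only [Pi.add_apply, norm_mul, norm_pow, norm_real, Real.norm_of_nonneg ht.le, norm_exp,
      Real.norm_of_nonneg (div_pos (Real.exp_pos (-b * t)) hq).le]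
    have e1 : (x * t * I : ℂ).re = 0 := by simp
    have e2 : (-(b : ℂ) * t).re = -b * t := by simp
    rw [e1, e2, Real.exp_zero, mul_one]
    calc t ^ (n + 1) * (Real.exp (-b * t) / (1 - Real.exp (-(2 * Real.pi * t))))
        = t ^ (n + 1) * Real.exp (-b * t) * (1 / (1 - Real.exp (-(2 * Real.pi * t)))) := by ring
      _ ≤ t ^ (n + 1) * Real.exp (-b * t) * (1 + 1 / (2 * Real.pi * t)) := by gcongr
      _ = _ := by
        field_simp
        ring

theorem hasSum_factorial_div_pow_integral (n : ℕ) (hn : 1 ≤ n) (x : ℝ) {b : ℝ} (hb : 0 < b) :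
    HasSum (fun k : ℕ => (n.factorial : ℂ) / (((b + 2 * Real.pi * k : ℝ) : ℂ) - x * I) ^ (n + 1))
      (∫ t in Ioi (0 : ℝ), (t : ℂ) ^ n * exp (x * t * I) *
        ((Real.exp (-b * t) / (1 - Real.exp (-(2 * Real.pi * t))) : ℝ) : ℂ)) := by
  have hpi := Real.pi_pos
  have hre : ∀ k : ℕ, (((b + 2 * Real.pi * k : ℝ) : ℂ) - x * I).re = b + 2 * Real.pi * k :=
    fun k => by simp
  have hpos : ∀ k : ℕ, 0 < (((b + 2 * Real.pi * k : ℝ) : ℂ) - x * I).re := fun k => by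
    rw [hre]; positivity
  have h := hasSum_integral_of_summable_integral_norm (μ := volume.restrict (Ioi (0 : ℝ)))
    (F := fun (k : ℕ) (t : ℝ) => (t : ℂ) ^ n *
      exp (-(((b + 2 * Real.pi * k : ℝ) : ℂ) - x * I) * t))
    (fun k => integrableOn_pow_mul_exp_neg_mul_Ioi n (hpos k)) (by
      simp only [integral_norm_pow_mul_exp_neg_mul_Ioi n (hpos _), hre]
      simp only [div_eq_mul_inv]
      refine Summable.mul_left _ ?_
      have hs := (Real.summable_one_div_nat_pow.2 (show 1 < n + 1 by omega)).mul_left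
        ((2 * Real.pi) ^ (n + 1))⁻¹
      -- The index `0` is skipped because the comparison term `1/0^(n+1)` is `0` there.
      rw [← summable_nat_add_iff 1] at hs ⊢
      refine hs.of_nonneg_of_le (fun k => by positivity) fun k => ?_
      rw [one_div, ← mul_inv, ← mul_pow]
      gcongr
      linarith)
  simp only [integral_pow_mul_exp_neg_mul_Ioi n (hpos _)] at h
  convert! h using 1
  refine setIntegral_congr_fun measurableSet_Ioi fun t ht => ?_
  have hg := hasSum_ofReal.2 (hasSum_exp_neg_arithmetic b ht)
  rw [← (hg.mul_left ((t : ℂ) ^ n * exp (x * t * I))).tsum_eq]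
  refine tsum_congr fun k => ?_
  rw [ofReal_exp, mul_assoc, ← exp_add]
  congr 2
  push_cast
  ring

/-- The phase `πn/2` in the sine is the argument of `I^n`. -/
theorem im_I_pow_mul_pow_mul_exp (n : ℕ) (x t r : ℝ) :
    (I ^ n * ((t : ℂ) ^ n * exp (x * t * I) * (r : ℂ))).im =
      Real.sin (x * t + Real.pi * n / 2) * (t ^ n * r) := by
  have hI : I ^ n = exp (((Real.pi * n / 2 : ℝ) : ℂ) * I) := by
    rw [show ((Real.pi * n / 2 : ℝ) : ℂ) * I = n * ((Real.pi : ℂ) / 2 * I) by push_cast; ring,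
      exp_nat_mul, exp_pi_div_two_mul_I]
  have e : I ^ n * ((t : ℂ) ^ n * exp (x * t * I) * (r : ℂ)) =
      ((t ^ n * r : ℝ) : ℂ) * exp (((x * t + Real.pi * n / 2 : ℝ) : ℂ) * I) := by
    rw [hI]
    have : exp (((x * t + Real.pi * n / 2 : ℝ) : ℂ) * I) =
        exp (((Real.pi * n / 2 : ℝ) : ℂ) * I) * exp (x * t * I) := by
      rw [← exp_add]
      congr 1
      push_cast
      ring
    rw [this]
    push_cast
    ring
  rw [e, im_ofReal_mul, exp_ofReal_mul_I_im, mul_comm]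

theorem integrableOn_sin_mul_pow_mul_exp_div (n : ℕ) (hn : 1 ≤ n) (x : ℝ) {b : ℝ} (hb : 0 < b) :
    IntegrableOn (fun t : ℝ => Real.sin (x * t + Real.pi * n / 2) *
      (t ^ n * (Real.exp (-b * t) / (1 - Real.exp (-(2 * Real.pi * t)))))) (Ioi 0) := by
  have h := ((integrableOn_pow_mul_exp_div n hn x hb).const_mul (I ^ n)).im
  refine h.congr (Filter.Eventually.of_forall fun t => ?_)
  exact im_I_pow_mul_pow_mul_exp n x t _

/-- Because `x + ci = i(c - xi)`, the powers of `i` combine to `(-1)^n i`, and `Im (i z) = Re z`. -/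
theorem im_I_pow_mul_div_pow (n : ℕ) (x c : ℝ) (r : ℝ) :
    (I ^ n * ((r : ℂ) / ((c : ℂ) - x * I) ^ (n + 1))).im =
      (-1) ^ n * ((r : ℂ) / ((x : ℂ) + c * I) ^ (n + 1)).re := by
  have e1 : ((x : ℂ) + c * I) = I * ((c : ℂ) - x * I) := by
    linear_combination (x : ℂ) * I_mul_I
  have e2 : I ^ n * ((r : ℂ) / ((c : ℂ) - x * I) ^ (n + 1)) =
      (((-1) ^ n : ℝ) : ℂ) * (I * ((r : ℂ) / ((x : ℂ) + c * I) ^ (n + 1))) := by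
    rw [e1, mul_pow]
    have hI : (-1 : ℂ) ^ n = I ^ n * I ^ n := by rw [← mul_pow, I_mul_I]
    have hI0 : I ^ n ≠ 0 := pow_ne_zero _ I_ne_zero
    push_cast
    rw [hI, pow_succ I, ← div_div]
    field_simp
  rw [e2, im_ofReal_mul, I_mul_im]

theorem hasSum_re_factorial_div_pow_integral (n : ℕ) (hn : 1 ≤ n) (x : ℝ) {b : ℝ} (hb : 0 < b) :
    HasSum (fun k : ℕ =>
      ((n.factorial : ℂ) / ((x : ℂ) + (b + 2 * Real.pi * k : ℝ) * I) ^ (n + 1)).re)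
      ((-1) ^ n * ∫ t in Ioi (0 : ℝ), Real.sin (x * t + Real.pi * n / 2) *
        (t ^ n * (Real.exp (-b * t) / (1 - Real.exp (-(2 * Real.pi * t)))))) := by
  have hint := (integrableOn_pow_mul_exp_div n hn x hb).const_mul (I ^ n)
  have h := (hasSum_im ((hasSum_factorial_div_pow_integral n hn x hb).mul_left (I ^ n))).mul_left
    ((-1 : ℝ) ^ n)
  have hsq : ((-1 : ℝ) ^ n) * (-1) ^ n = 1 := by rw [← mul_pow]; simp
  convert! h using 1
  · ext k
    have := im_I_pow_mul_div_pow n x (b + 2 * Real.pi * k) n.factorial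
    rw [ofReal_natCast] at this
    rw [this, ← mul_assoc, hsq, one_mul]
  · congr 1
    rw [← integral_const_mul]
    refine Eq.trans ?_ (integral_im hint)
    refine integral_congr_ae (Filter.Eventually.of_forall fun t => ?_)
    exact (im_I_pow_mul_pow_mul_exp n x t _).symm

/-! ### Lipschitz formula and the sine integrals -/

/-- The Lipschitz formula on the line `Re z = β`. -/
theorem hasSum_int_factorial_div_pow (n : ℕ) (hn : 1 ≤ n) {x : ℝ} (hx : 0 < x) (β : ℝ) :
    HasSum (fun d : ℤ => (n.factorial : ℂ) / ((x : ℂ) - 2 * Real.pi * (β + d) * I) ^ (n + 1))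
      (∑' m : ℕ, (m : ℂ) ^ n * (exp (-x) * exp (2 * Real.pi * β * I)) ^ m) := by
  have hpi : (Real.pi : ℂ) ≠ 0 := ofReal_ne_zero.2 Real.pi_ne_zero
  -- Chosen so that `-2πi(z + d) = x - 2πi(β + d)` and `e^(2πiz) = e^(-x) e^(2πiβ)`.
  obtain ⟨z, hz⟩ : ∃ z : ℂ, z = β + ((x / (2 * Real.pi) : ℝ) : ℂ) * I := ⟨_, rfl⟩
  have him : 0 < z.im := by
    have : z.im = x / (2 * Real.pi) := by
      simp only [hz, add_im, ofReal_im, im_ofReal_mul, I_im, mul_one, zero_add]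
    rw [this]
    have := Real.pi_pos
    positivity
  have hq := EisensteinSeries.qExpansion_identity hn ⟨z, him⟩
  have hsum : Summable fun d : ℤ => 1 / (z + d) ^ (n + 1) := by
    have := EisensteinSeries.linear_right_summable z 1 (k := (n + 1 : ℕ)) (by omega)
    simpa only [zpow_natCast, Int.cast_one, one_mul, one_div] using this
  have hc : (-2 * Real.pi * I : ℂ) ≠ 0 := by simp [hpi]
  have hf : (n.factorial : ℂ) ≠ 0 := Nat.cast_ne_zero.2 n.factorial_ne_zero
  have h := hsum.hasSum.mul_left ((n.factorial : ℂ) / (-2 * Real.pi * I) ^ (n + 1))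
  have hq' : ∑' d : ℤ, 1 / (z + d) ^ (n + 1) = ((-2 * Real.pi * I) ^ (n + 1) / n.factorial) *
    ∑' m : ℕ, (m : ℂ) ^ n * exp (2 * Real.pi * I * z) ^ m := hq
  have hzx : -2 * Real.pi * I * z = x - 2 * Real.pi * β * I := by
    rw [hz]
    push_cast
    field_simp
    linear_combination (-(x : ℂ)) * I_mul_I
  convert! h using 1
  · ext d
    rw [div_mul_div_comm, mul_one, ← mul_pow]
    congr 2
    linear_combination -hzx
  · rw [hq', ← exp_add]
    have : (n.factorial : ℂ) / (-2 * Real.pi * I) ^ (n + 1) *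
        ((-2 * Real.pi * I) ^ (n + 1) / n.factorial) = 1 := by
      have := pow_ne_zero (n + 1) hc
      field_simp
    rw [← mul_assoc, this, one_mul]
    refine tsum_congr fun m => ?_
    congr 3
    linear_combination hzx

theorem natCast_div_pow_add_conj (n r : ℕ) (x c : ℝ) :
    (r : ℂ) / ((x : ℂ) - c * I) ^ n + (r : ℂ) / ((x : ℂ) + c * I) ^ n =
      ((2 * ((r : ℂ) / ((x : ℂ) + c * I) ^ n).re : ℝ) : ℂ) := by
  have h := add_conj ((r : ℂ) / ((x : ℂ) + c * I) ^ n)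
  rw [← h, add_comm]
  simp [sub_eq_add_neg]

end Complex

open Complex in
theorem geomPoly_exp_sub_one_eq_integral (n : ℕ) (hn : 1 ≤ n) {x : ℝ} (hx : 0 < x) :
    Real.exp x / (Real.exp x - 1) * geomPoly n (1 / (Real.exp x - 1)) =
      (Nat.factorial n : ℝ) / x ^ (n + 1) +
        2 * (-1) ^ n * ∫ t in Ioi (0 : ℝ), Real.sin (x * t + Real.pi * n / 2) *
          (t ^ n * (Real.exp (-(2 * Real.pi) * t) / (1 - Real.exp (-(2 * Real.pi * t))))) := by
  have hL := hasSum_int_factorial_div_pow n hn hx 0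
  have hval : ∑' m : ℕ, (m : ℂ) ^ n * (exp (-x) * exp (2 * Real.pi * (0 : ℝ) * I)) ^ m =
      ((Real.exp x / (Real.exp x - 1) * geomPoly n (1 / (Real.exp x - 1)) : ℝ) : ℂ) := by
    rw [← (hasSum_ofReal.2 (hasSum_pow_mul_exp_neg n hx)).tsum_eq]
    refine tsum_congr fun m => ?_
    simp
  rw [hval] at hL
  -- Pairing `d` with `-d` counts `d = 0` twice; removing index `0` takes both copies away, a net
  -- loss of the single term `n!/x^(n+1)`.
  have h1 := (hasSum_nat_add_iff' 1).2 hL.nat_add_neg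
  have h2 := hasSum_ofReal.2 ((hasSum_re_factorial_div_pow_integral n hn x
    (b := 2 * Real.pi) (by have := Real.pi_pos; positivity)).mul_left 2)
  have hterm : ∀ k : ℕ, (n.factorial : ℂ) /
        ((x : ℂ) - 2 * Real.pi * ((0 : ℝ) + ((k + 1 : ℕ) : ℤ)) * I) ^ (n + 1) +
      (n.factorial : ℂ) /
        ((x : ℂ) - 2 * Real.pi * ((0 : ℝ) + ((-((k + 1 : ℕ) : ℤ) : ℤ))) * I) ^ (n + 1) =
      ((2 * ((n.factorial : ℂ) /
        ((x : ℂ) + (2 * Real.pi + 2 * Real.pi * k : ℝ) * I) ^ (n + 1)).re : ℝ) : ℂ) := fun k => by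
    rw [← natCast_div_pow_add_conj]
    congr 3 <;> push_cast <;> ring
  simp only [hterm] at h1
  have h3 := h1.unique h2
  simp only [Finset.sum_range_one, Nat.cast_zero, Int.cast_zero, neg_zero, ofReal_zero, add_zero,
    mul_zero, zero_mul, sub_zero] at h3
  apply ofReal_injective
  rw [ofReal_mul 2] at h3
  rw [ofReal_add, mul_assoc, ofReal_mul 2]
  push_cast at h3 ⊢
  linear_combination h3

open Complex in
theorem geomPoly_exp_add_one_eq_integral (n : ℕ) (hn : 1 ≤ n) {x : ℝ} (hx : 0 < x) :
    Real.exp x / (Real.exp x + 1) * geomPoly n (-1 / (Real.exp x + 1)) =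
      2 * (-1) ^ n * ∫ t in Ioi (0 : ℝ), Real.sin (x * t + Real.pi * n / 2) *
          (t ^ n * (Real.exp (-Real.pi * t) / (1 - Real.exp (-(2 * Real.pi * t))))) := by
  have hL := hasSum_int_factorial_div_pow n hn hx (1 / 2)
  have hval : ∑' m : ℕ, (m : ℂ) ^ n * (exp (-x) * exp (2 * Real.pi * (1 / 2 : ℝ) * I)) ^ m =
      ((Real.exp x / (Real.exp x + 1) * geomPoly n (-1 / (Real.exp x + 1)) : ℝ) : ℂ) := by
    have h := hasSum_pow_mul_geometric n (z := -Real.exp (-x)) (by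
      rw [abs_neg, abs_of_pos (Real.exp_pos _)]
      exact Real.exp_lt_one_iff.2 (by linarith))
    have h0 := Real.exp_pos x
    have e1 : 1 / (1 - -Real.exp (-x)) = Real.exp x / (Real.exp x + 1) := by
      rw [Real.exp_neg, sub_neg_eq_add]
      field_simp
    have e2 : -Real.exp (-x) / (1 - -Real.exp (-x)) = -1 / (Real.exp x + 1) := by
      rw [Real.exp_neg, sub_neg_eq_add]
      field_simp
    rw [e1, e2] at h
    rw [← (hasSum_ofReal.2 h).tsum_eq]
    refine tsum_congr fun m => ?_
    rw [show 2 * (Real.pi : ℂ) * (1 / 2 : ℝ) * I = Real.pi * I by push_cast; ring, exp_pi_mul_I]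
    push_cast
    ring
  rw [hval] at hL
  -- With `β = 1/2` the conjugate partner of `d` is `-d - 1`; no term is left unpaired, hence no
  -- `n!/x^(n+1)` here.
  have h1 := hL.nat_add_neg_add_one
  have h2 := hasSum_ofReal.2 ((hasSum_re_factorial_div_pow_integral n hn x
    (b := Real.pi) Real.pi_pos).mul_left 2)
  have hterm : ∀ k : ℕ, (n.factorial : ℂ) /
        ((x : ℂ) - 2 * Real.pi * ((1 / 2 : ℝ) + (k : ℤ)) * I) ^ (n + 1) +
      (n.factorial : ℂ) /
        ((x : ℂ) - 2 * Real.pi * ((1 / 2 : ℝ) + ((-((k : ℤ) + 1) : ℤ))) * I) ^ (n + 1) =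
      ((2 * ((n.factorial : ℂ) /
        ((x : ℂ) + (Real.pi + 2 * Real.pi * k : ℝ) * I) ^ (n + 1)).re : ℝ) : ℂ) := fun k => by
    rw [← natCast_div_pow_add_conj]
    congr 3 <;> push_cast <;> ring
  simp only [hterm] at h1
  rw [mul_assoc]
  exact ofReal_injective (h1.unique h2)

/-! ### Assembly of the four identities -/

theorem mainTheorem7 :
    (∀ (n : ℕ) (r x a : ℝ), 0 ≤ r → 0 < x → x < 1 → 0 < a → a < 1 →
      Complex.VerticalIntegrable (fun s : ℂ =>
        (x : ℂ) ^ (-s) * s ^ n * Complex.Gamma s * Complex.Gamma ((r : ℂ) + 1 - s)) a ∧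
      ((1 / (1 + x) ^ (r + 1) * genGeomPoly n (r + 1) (-x / (1 + x)) : ℝ) : ℂ) =
        (-1) ^ n / (2 * (Real.pi : ℂ) * Complex.I * Complex.Gamma ((r : ℂ) + 1)) *
          vertLineIntegral a (fun s : ℂ =>
            (x : ℂ) ^ (-s) * s ^ n * Complex.Gamma s * Complex.Gamma ((r : ℂ) + 1 - s))) ∧
    (∀ (n : ℕ) (x a : ℝ), 0 < x → (n : ℝ) + 1 < a →
      Complex.VerticalIntegrable (fun s : ℂ =>
        (x : ℂ) ^ (-s) * riemannZeta (s - (n : ℂ)) * Complex.Gamma s) a ∧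
      ((Real.exp x / (Real.exp x - 1) * geomPoly n (1 / (Real.exp x - 1)) : ℝ) : ℂ) =
        (if n = 0 then 1 else 0) +
          1 / (2 * (Real.pi : ℂ) * Complex.I) *
            vertLineIntegral a (fun s : ℂ =>
              (x : ℂ) ^ (-s) * riemannZeta (s - (n : ℂ)) * Complex.Gamma s)) ∧
    (∀ (n : ℕ) (x : ℝ), 1 ≤ n → 0 < x →
      IntegrableOn (fun t : ℝ =>
        Real.sin (x * t + Real.pi * n / 2) * (t ^ n / Real.sinh (Real.pi * t))) (Ioi 0) ∧
      Real.exp x / (Real.exp x + 1) * geomPoly n (-1 / (Real.exp x + 1)) =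
        (-1) ^ n * ∫ t in Ioi (0 : ℝ),
          Real.sin (x * t + Real.pi * n / 2) * (t ^ n / Real.sinh (Real.pi * t))) ∧
    (∀ (n : ℕ) (x : ℝ), 1 ≤ n → 0 < x →
      IntegrableOn (fun t : ℝ =>
        Real.sin (x * t + Real.pi * n / 2) * (t ^ n / (Real.exp (2 * Real.pi * t) - 1)))
        (Ioi 0) ∧
      Real.exp x / (Real.exp x - 1) * geomPoly n (1 / (Real.exp x - 1)) =
        (Nat.factorial n : ℝ) / x ^ (n + 1) +
          2 * (-1) ^ n * ∫ t in Ioi (0 : ℝ),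
            Real.sin (x * t + Real.pi * n / 2) *
              (t ^ n / (Real.exp (2 * Real.pi * t) - 1))) := by

  refine ⟨fun n r x a hr hx _ ha ha1 => ?_, fun n x a hx ha => ?_, fun n x hn hx => ?_,
    fun n x hn hx => ?_⟩
  · have h1 := Complex.verticalIntegrable_cpow_mul_pow_mul_Gamma_mul_Gamma_sub n (ρ := r + 1) hx ha
      (by linarith)
    have h2 := Complex.genGeomPoly_eq_vertLineIntegral n (ρ := r + 1) hx ha (by linarith)
    simp only [Complex.ofReal_add, Complex.ofReal_one] at h1
    rw [Complex.ofReal_add r 1, Complex.ofReal_one] at h2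
    exact ⟨h1, h2⟩
  · exact ⟨Complex.verticalIntegrable_cpow_mul_riemannZeta_mul_Gamma n hx ha,
      geomPoly_eq_vertLineIntegral_riemannZeta n hx ha⟩
  · have hker : ∀ t : ℝ, t ∈ Ioi (0 : ℝ) →
        2 * (Real.sin (x * t + Real.pi * n / 2) *
          (t ^ n * (Real.exp (-Real.pi * t) / (1 - Real.exp (-(2 * Real.pi * t)))))) =
        Real.sin (x * t + Real.pi * n / 2) * (t ^ n / Real.sinh (Real.pi * t)) := fun t ht => by
      -- The factor `2` from the conjugate pairs is absorbed into `sinh`.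
      have hsinh : 2 * Real.exp (-Real.pi * t) / (1 - Real.exp (-(2 * Real.pi * t))) =
          1 / Real.sinh (Real.pi * t) := by
        have hpos : 0 < Real.pi * t := mul_pos Real.pi_pos ht
        have hq : Real.exp (-(2 * Real.pi * t)) = Real.exp (-(Real.pi * t)) ^ 2 := by
          rw [← Real.exp_nat_mul]
          congr 1
          push_cast
          ring
        have hs := (Real.sinh_pos_iff.2 hpos).ne'
        have hlt : Real.exp (-(Real.pi * t)) ^ 2 < 1 :=
          pow_lt_one₀ (Real.exp_pos _).le (Real.exp_lt_one_iff.2 (by linarith)) two_ne_zero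
        rw [hq, neg_mul, div_eq_div_iff (by linarith) hs, Real.sinh_eq]
        have : Real.exp (-(Real.pi * t)) * Real.exp (Real.pi * t) = 1 := by
          rw [← Real.exp_add]; simp
        linear_combination this
      rw [div_eq_mul_one_div (t ^ n), ← hsinh]
      ring
    refine ⟨IntegrableOn.congr_fun
      ((Complex.integrableOn_sin_mul_pow_mul_exp_div n hn x Real.pi_pos).const_mul 2)
      hker measurableSet_Ioi, ?_⟩
    rw [geomPoly_exp_add_one_eq_integral n hn hx, mul_comm (2 : ℝ), mul_assoc,
      ← integral_const_mul, setIntegral_congr_fun measurableSet_Ioi hker]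
  · have hker : ∀ t : ℝ, t ∈ Ioi (0 : ℝ) →
        Real.sin (x * t + Real.pi * n / 2) *
          (t ^ n * (Real.exp (-(2 * Real.pi) * t) / (1 - Real.exp (-(2 * Real.pi * t))))) =
        Real.sin (x * t + Real.pi * n / 2) * (t ^ n / (Real.exp (2 * Real.pi * t) - 1)) :=
      fun t ht => by
        have hpos : 0 < 2 * Real.pi * t := mul_pos Real.two_pi_pos ht
        rw [neg_mul, (one_div_one_sub_exp_neg hpos).2, mul_one_div]
    refine ⟨(Complex.integrableOn_sin_mul_pow_mul_exp_div n hn x Real.two_pi_pos).congr_fun hker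
      measurableSet_Ioi, ?_⟩
    rw [geomPoly_exp_sub_one_eq_integral n hn hx, setIntegral_congr_fun measurableSet_Ioi hker]
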